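/- Let $\mathcal L$ be an algebraic language (function symbols only; nullary ones are called constants). Algebras have non-empty universes. Fix a countably infinite set of variables and let $\mathrm{Tm}$ be the algebra of $\mathcal L$-terms over it. A quasiequation $\Sigma\Rightarrow\varphi\approx\psi$ ($\Sigma$ a finite set of equations) is valid in a class $\mathcal K$ of algebras if for every $A\in\mathcal K$ and homomorphism $h\colon\mathrm{Tm}\to A$ that satisfies all equations of $\Sigma$, $h(\varphi)=h(\psi)$. It is $\mathcal K$-admissible if every endomorphism $\sigma$ of $\mathrm{Tm}$ for which all equations $\sigma(s)\approx\sigma(t)$ with $(s\approx t)\in\Sigma$ are valid in $\mathcal K$ also makes $\sigma(\varphi)\approx\sigma(\psi)$ valid in $\mathcal K$. $\mathbb Q(\mathcal K)$ is the smallest class containing $\mathcal K$ that is axiomatized by quasiequations. $F_{\mathcal K}(X)$ is the quotient of the term algebra over $X$ by the intersection of all its congruences $\theta$ whose quotient embeds into a member of $\mathcal K$ (the full relation if there are none); $F_{\mathcal K}(m)$ and $F_{\mathcal K}(\omega)$ are the cases of $m$ and of countably infinitely many generators ($F_{\mathcal K}(0)$ exists only if there are constants). Finite multisets of natural numbers are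 ordered by: $M\le_m N$ iff for every $x$ occurring more often in $M$ than in $N$ there is some $y>x$ occurring more often in $N$ than in $M$. A finite (possibly empty) set $\{A_1,\dots,A_n\}$ of finite algebras is a minimal generating set for a quasivariety $\mathcal Q$ if $\mathbb Q(A_1,\dots,A_n)=\mathcal Q$ and $[|A_1|,\dots,|A_n|]\le_m[|B_1|,\dots,|B_k|]$ for every finite set $\{B_1,\dots,B_k\}$ of finite algebras with $\mathbb Q(B_1,\dots,B_k)=\mathcal Q$. $\mathrm{MinGenSet}(\mathcal K)$ lists $\mathcal K$ as $\mathcal M$ and treats the algebras $A$ of the list (including those added later) in turn. With $\Delta_A$ the identity congruence, let $S_1$ (resp. $S_2$) be the set of congruences $\theta\ne\Delta_A$ of $A$ such that $A/\theta$ embeds into $A$ (resp. into another algebra of the list). If $\bigcap(S_1\cup S_2)=\Delta_A$ (the empty intersection being the full relation), it appends $A/\theta$ to $\mathcal M$ for each $\theta\in S_1\setminus S_2$ and removes $A$; otherwise it keeps $A$. After that it goes once through the list and removes each algebra that embeds into another algebra of the current list, and returns the set of the remaining algebras. $\mathrm{AdmAlgs}(\mathcal K)$ computes $\mathcal D=\mathrm{MinGenSet}(\mathcal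 K)$ and starts with $\mathcal A=\emptyset$. For each $A\in\mathcal D$, it tries $m=0,1,2,\dots$ (starting with $m=1$ if there are no constants) until $A$ is a homomorphic image of $F_{\mathcal D}(m)$, and sets $B=F_{\mathcal D}(m)$; as long as $B$ has a proper subalgebra of which $A$ is a homomorphic image, it replaces $B$ by such a subalgebra; then it adds $B$ to $\mathcal A$. Finally it returns $\mathrm{MinGenSet}(\mathcal A)$. Orders of traversal and the choice of subalgebras are arbitrary. Theorem. Let $\mathcal K$ be a finite set of finite $\mathcal L$-algebras. Every run of $\mathrm{AdmAlgs}(\mathcal K)$, however the choices are made, stops after finitely many steps and returns a finite set $\mathcal R$ of finite algebras such that: 1. $\mathcal R$ is a minimal generating set for $\mathbb Q(F_{\mathcal K}(\omega))$, and every minimal generating set $\mathcal S$ for $\mathbb Q(F_{\mathcal K}(\omega))$ agrees with $\mathcal R$ up to isomorphism (there is a bijection $\mathcal R\to\mathcal S$ that sends each algebra to an isomorphic one). 2. A quasiequation is $\mathcal K$-admissible if and only if it is valid in $\mathcal R$; and among all finite sets of finite algebras with this property, $\mathcal R$ has the $\le_m$-least multiset of cardinalities and is, up to isomorphism, the only one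 with this multiset of cardinalities. -/

import Mathlib

universe u v

namespace UAlg

open FirstOrder FirstOrder.Language

/-! ## Algebras, quotients, subalgebras

An algebraic language is a first-order language `L` without relation symbols (`L.IsAlgebraic`). -/

/-- An `L`-algebra: a non-empty set with an interpretation of the function symbols of `L`. -/
structure Alg (L : FirstOrder.Language.{u, v}) : Type (max (u + 1) v) where
  carrier : Type u
  [str : L.Structure carrier]
  [nonempty : Nonempty carrier]

attribute [instance] Alg.str Alg.nonempty

instance (L : FirstOrder.Language.{u, v}) : CoeSort (Alg L) (Type u) := ⟨Alg.carrier⟩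

variable {L : FirstOrder.Language.{u, v}}

/-- `A` is isomorphic to a subalgebra of `B`. -/
def Embeds (A B : Alg L) : Prop := Nonempty (A ↪[L] B)

/-- `A` and `B` are isomorphic. -/
def Iso (A B : Alg L) : Prop := Nonempty (A ≃[L] B)

/-- `A` is a homomorphic image of `B`. -/
def IsHomImage (A B : Alg L) : Prop := ∃ f : B →[L] A, Function.Surjective f

/-- A congruence: an equivalence relation compatible with all operations. -/
structure Congruence (L : FirstOrder.Language.{u, v}) (A : Type u) [L.Structure A] extends Setoid A where
  map_rel : ∀ {n : ℕ} (f : L.Functions n) (x y : Fin n → A),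
    (∀ i, toSetoid.r (x i) (y i)) →
      toSetoid.r (Structure.funMap f x) (Structure.funMap f y)

/-- A congruence as a Mathlib prestructure, which provides the operations of the quotient. -/
@[reducible]
def Congruence.prestructure [L.IsAlgebraic] {A : Type u} [inst : L.Structure A]
    (θ : Congruence L A) : L.Prestructure θ.toSetoid where
  toStructure := inst
  fun_equiv := fun {_} {f} x y h => θ.map_rel f x y h
  rel_equiv := fun {_} {r} _ _ _ => isEmptyElim r

/-- The quotient algebra `A / θ`. -/
def quot [L.IsAlgebraic] (A : Alg L) (θ : Congruence L A) : Alg L :=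
  letI := θ.prestructure
  { carrier := Quotient θ.toSetoid
    str := quotientStructure
    nonempty := A.nonempty.map (Quotient.mk θ.toSetoid) }

/-- A subalgebra with non-empty universe, as an algebra. -/
def sub (A : Alg L) (C : L.Substructure A) (hC : (C : Set A).Nonempty) : Alg L :=
  { carrier := C
    str := Substructure.inducedStructure
    nonempty := hC.to_subtype }

/-! ## Terms, quasiequations, quasivarieties -/

/-- The term algebra structure on the set of `L`-terms over the variables `X`. -/
instance termStructure (X : Type) : L.Structure (L.Term X) where
  funMap f ts := Term.func f ts
  RelMap _ _ := False

/-- The term algebra over `X`; it exists if `X` is non-empty or `L` has a constant symbol. -/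
def termAlg (L : FirstOrder.Language.{u, v}) (X : Type) [Nonempty (L.Term X)] : Alg L :=
  { carrier := L.Term X
    str := termStructure X }

/-- An equation is an ordered pair of terms over a fixed countably infinite set of variables. -/
abbrev Equation (L : FirstOrder.Language.{u, v}) : Type u := L.Term ℕ × L.Term ℕ

/-- A quasiequation `Σ ⇒ φ ≈ ψ`, where `Σ` is a finite set of equations. -/
structure QuasiEquation (L : FirstOrder.Language.{u, v}) : Type u where
  premises : Finset (Equation L)
  conclusion : Equation L

/-- `K`-validity of a quasiequation. -/
def Valid (K : Set (Alg L)) (q : QuasiEquation L) : Prop :=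
  ∀ A ∈ K, ∀ h : L.Term ℕ →[L] A,
    (∀ e ∈ q.premises, h e.1 = h e.2) → h q.conclusion.1 = h q.conclusion.2

/-- `K`-validity of an equation. -/
def ValidEq (K : Set (Alg L)) (e : Equation L) : Prop :=
  ∀ A ∈ K, ∀ h : L.Term ℕ →[L] A, h e.1 = h e.2

/-- The substitution `σ` is a `K`-unifier of the equation `e`. -/
def Unifies (K : Set (Alg L)) (σ : L.Term ℕ →[L] L.Term ℕ) (e : Equation L) : Prop :=
  ValidEq K (σ e.1, σ e.2)

/-- `K`-admissibility of a quasiequation: every `K`-unifier of the premises is a `K`-unifier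
of the conclusion. -/
def Admissible (K : Set (Alg L)) (q : QuasiEquation L) : Prop :=
  ∀ σ : L.Term ℕ →[L] L.Term ℕ, (∀ e ∈ q.premises, Unifies K σ e) → Unifies K σ q.conclusion

/-- A quasivariety is a class of algebras axiomatized by a set of quasiequations. -/
def IsQuasivariety (C : Set (Alg L)) : Prop :=
  ∃ Λ : Set (QuasiEquation L), ∀ A : Alg L, A ∈ C ↔ ∀ q ∈ Λ, Valid {A} q

/-- `Q(K)`, the smallest quasivariety containing `K`. -/
def quasivariety (K : Set (Alg L)) : Set (Alg L) :=
  {A | ∀ C : Set (Alg L), IsQuasivariety C → K ⊆ C → A ∈ C}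

theorem quasivariety_isLeast (K : Set (Alg L)) :
    IsLeast {C : Set (Alg L) | IsQuasivariety C ∧ K ⊆ C} (quasivariety K) := by
  refine ⟨⟨⟨{q | Valid K q}, fun A => ⟨fun hA => ?_, fun hA C hC hKC => ?_⟩⟩,
    fun A hA C _ hKC => hKC hA⟩, fun C hC A hA => hA C hC.1 hC.2⟩
  · exact hA {B | ∀ q ∈ {q | Valid K q}, Valid {B} q} ⟨_, fun _ => Iff.rfl⟩
      (fun B hB q hq B' hB' => by
        rw [Set.mem_singleton_iff] at hB'
        subst hB'
        exact hq B' hB)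
  · obtain ⟨Λ, hΛ⟩ := hC
    exact (hΛ A).2 fun q hq => hA q fun B hB => (hΛ B).1 (hKC hB) q hq B rfl

/-! ## Free algebras -/

/-- The congruence `θ_K(X)` on the term algebra over `X`: the intersection of all congruences
`φ` such that the quotient by `φ` is isomorphic to a subalgebra of a member of `K`. -/
def freeCongruence [L.IsAlgebraic] (K : Set (Alg L)) (X : Type) [Nonempty (L.Term X)] :
    Congruence L (termAlg L X) where
  toSetoid := sInf {s | ∃ φ : Congruence L (termAlg L X),
    φ.toSetoid = s ∧ ∃ A ∈ K, Embeds (quot (termAlg L X) φ) A}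
  map_rel := fun f x y h s hs => by
    obtain ⟨φ, rfl, hφ⟩ := hs
    exact φ.map_rel f x y fun i => h i φ.toSetoid ⟨φ, rfl, hφ⟩

/-- The free algebra of `K` over the generators `X`, as a quotient of the term algebra. -/
def freeAlg [L.IsAlgebraic] (K : Set (Alg L)) (X : Type) [Nonempty (L.Term X)] : Alg L :=
  quot (termAlg L X) (freeCongruence K X)

instance (L : FirstOrder.Language.{u, v}) : Nonempty (L.Term ℕ) := ⟨Term.var 0⟩

/-- `F_K(ω)`, the free algebra of `K` on countably infinitely many generators. -/
def freeOmega [L.IsAlgebraic] (K : Set (Alg L)) : Alg L := freeAlg K ℕ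

/-! ## Minimal generating sets -/

/-- The multiset `[|A₁|, …, |Aₙ|]` of cardinalities of a set `{A₁, …, Aₙ}` of finite algebras. -/
noncomputable def sizes (R : Finset (Alg L)) : Multiset ℕ :=
  R.val.map fun A : Alg L => Nat.card A.carrier

/-- The multiset ordering on finite multisets of natural numbers. -/
def MultisetLE (M N : Multiset ℕ) : Prop :=
  ∀ x, N.count x < M.count x → ∃ y, x < y ∧ M.count y < N.count y

/-- A finite set of finite algebras. -/
def FinAlgs (R : Finset (Alg L)) : Prop := ∀ A ∈ R, Finite A

/-- `R` is a minimal generating set for the quasivariety `Q`. -/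
def IsMinGenSet (Q : Set (Alg L)) (R : Finset (Alg L)) : Prop :=
  FinAlgs R ∧ quasivariety (R : Set (Alg L)) = Q ∧
    ∀ S : Finset (Alg L), FinAlgs S → quasivariety (S : Set (Alg L)) = Q →
      MultisetLE (sizes R) (sizes S)

/-- Validity in `R` coincides with `K`-admissibility. -/
def CapturesAdmissibility (K R : Set (Alg L)) : Prop :=
  ∀ q : QuasiEquation L, Admissible K q ↔ Valid R q

/-- `R` is an optimal finite set of finite algebras in which validity captures
`K`-admissibility. -/
def IsOptimalForAdmissibility (K : Set (Alg L)) (R : Finset (Alg L)) : Prop :=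
  FinAlgs R ∧ CapturesAdmissibility K (R : Set (Alg L)) ∧
    ∀ S : Finset (Alg L), FinAlgs S → CapturesAdmissibility K (S : Set (Alg L)) →
      MultisetLE (sizes R) (sizes S)

/-- Two finite sets of algebras agree up to isomorphism of their members. -/
def SameUpToIso (R S : Finset (Alg L)) : Prop :=
  ∃ e : {A // A ∈ R} ≃ {A // A ∈ S}, ∀ A, Iso A.1 (e A).1

/-! ## The algorithms

Both algorithms are given as transition systems at the level of their pseudocode. Choices that the
pseudocode leaves open (the order in which a set is traversed, which suitable subalgebra a search
returns) are left nondeterministic, so that a run is a run of any implementation. -/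

/-- The list `l` lists the elements of the finite set `K` without repetition, in some order. -/
def Lists {α : Type*} (l : List α) (K : Finset α) : Prop := l.Nodup ∧ ∀ a, a ∈ l ↔ a ∈ K

section MinGenSet

variable [L.IsAlgebraic]

/-- The congruences `θ ≠ Δ` of `A` such that `A / θ` embeds into `A`. -/
def S₁ (A : Alg L) : Set (Congruence L A) :=
  {θ | θ.toSetoid ≠ ⊥ ∧ Embeds (quot A θ) A}

/-- The congruences `θ ≠ Δ` of `A` such that `A / θ` embeds into an algebra of the list `M`. -/
def S₂ (A : Alg L) (M : List (Alg L)) : Set (Congruence L A) :=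
  {θ | θ.toSetoid ≠ ⊥ ∧ ∃ B ∈ M, Embeds (quot A θ) B}

/-- The intersection of a set of congruences of `A` (the full relation for the empty set). -/
def meet {A : Alg L} (S : Set (Congruence L A)) : Setoid A :=
  sInf (Congruence.toSetoid '' S)

/-- Configurations of `MinGenSet`. In `scan done todo` (the while loop) the list is
`done ++ todo` and the current algebra is the head of `todo`; in `prune kept todo` (the final
loop over the list) the list is `kept ++ todo` and the current algebra is the head of `todo`. -/
inductive MGConfig (L : FirstOrder.Language.{u, v}) : Type (max (u + 1) v)
  | scan (done todo : List (Alg L))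
  | prune (kept todo : List (Alg L))

/-- One step of `MinGenSet`. -/
inductive MGStep : MGConfig L → MGConfig L → Prop
  /-- `⋂ (S₁ ∪ S₂) = Δ`: append all `A / θ` with `θ ∈ S₁ \ S₂` to the list and remove `A`. -/
  | split (done todo : List (Alg L)) (A : Alg L) (ts : List (Congruence L A)) :
      meet (S₁ A ∪ S₂ A (done ++ todo)) = ⊥ →
      ts.Nodup → (∀ θ, θ ∈ ts ↔ θ ∈ S₁ A \ S₂ A (done ++ todo)) →
      MGStep (.scan done (A :: todo)) (.scan done (todo ++ ts.map (quot A)))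
  /-- `⋂ (S₁ ∪ S₂) ≠ Δ`: go on to the next algebra. -/
  | next (done todo : List (Alg L)) (A : Alg L) :
      meet (S₁ A ∪ S₂ A (done ++ todo)) ≠ ⊥ →
      MGStep (.scan done (A :: todo)) (.scan (done ++ [A]) todo)
  /-- The end of the list is reached: start the final loop. -/
  | scanned (done : List (Alg L)) : MGStep (.scan done []) (.prune [] done)
  /-- `A` embeds into another algebra of the list: remove it. -/
  | drop (kept todo : List (Alg L)) (A : Alg L) :
      (∃ B ∈ kept ++ todo, Embeds A B) →
      MGStep (.prune kept (A :: todo)) (.prune kept todo)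
  /-- `A` embeds into no other algebra of the list: keep it. -/
  | keep (kept todo : List (Alg L)) (A : Alg L) :
      (¬ ∃ B ∈ kept ++ todo, Embeds A B) →
      MGStep (.prune kept (A :: todo)) (.prune (kept ++ [A]) todo)

/-- `MinGenSet` has finished in the configuration `c` and returns the set `R`. -/
def MGReturns (c : MGConfig L) (R : Finset (Alg L)) : Prop :=
  ∃ kept : List (Alg L), c = .prune kept [] ∧ ∀ A, A ∈ R ↔ A ∈ kept

end MinGenSet

section AdmAlgs

variable [L.IsAlgebraic]

/-- Configurations of `AdmAlgs`. Here `D` is the result of the first call of `MinGenSet`, `todo`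
lists the elements of `D` that the main loop has still to treat, and `𝒜` is the set of algebras
collected so far. -/
inductive Config (L : FirstOrder.Language.{u, v}) : Type (max (u + 1) v)
  /-- Inside the call of `MinGenSet` on the input. -/
  | first (c : MGConfig L)
  /-- At the head of the main loop. -/
  | loop (D : Finset (Alg L)) (todo : List (Alg L)) (𝒜 : Finset (Alg L))
  /-- Inside the call `Free(A, D)`, about to examine the free algebra on `m` generators. -/
  | free (D : Finset (Alg L)) (todo : List (Alg L)) (𝒜 : Finset (Alg L)) (A : Alg L) (m : ℕ)
  /-- In the inner loop of the treatment of `A`, with the current algebra `B`. -/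
  | shrink (D : Finset (Alg L)) (todo : List (Alg L)) (𝒜 : Finset (Alg L)) (A B : Alg L)
  /-- Inside the call of `MinGenSet` on the collected set. -/
  | last (c : MGConfig L)
  /-- Finished, returning `R`. -/
  | done (R : Finset (Alg L))

open Classical in
/-- One step of `AdmAlgs`. -/
inductive Step : Config L → Config L → Prop
  | first (c c' : MGConfig L) : MGStep c c' → Step (.first c) (.first c')
  /-- `D ← MinGenSet(K)`, `𝒜 ← ∅`. -/
  | enter (c : MGConfig L) (D : Finset (Alg L)) (l : List (Alg L)) :
      MGReturns c D → Lists l D → Step (.first c) (.loop D l ∅)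
  /-- Treat the next `A ∈ D`: call `Free(A, D)`. -/
  | pick (D : Finset (Alg L)) (todo : List (Alg L)) (𝒜 : Finset (Alg L)) (A : Alg L) :
      Step (.loop D (A :: todo) 𝒜) (.free D todo 𝒜 A 0)
  /-- `F_D(m)` exists and has `A` as a homomorphic image: `B ← F_D(m)`. -/
  | found (D : Finset (Alg L)) (todo : List (Alg L)) (𝒜 : Finset (Alg L)) (A : Alg L) (m : ℕ)
      (hm : Nonempty (L.Term (Fin m))) :
      IsHomImage A (freeAlg (D : Set (Alg L)) (Fin m)) →
      Step (.free D todo 𝒜 A m) (.shrink D todo 𝒜 A (freeAlg (D : Set (Alg L)) (Fin m)))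
  /-- Otherwise (also if there is no term on `m` generators): try `m + 1` generators. -/
  | more (D : Finset (Alg L)) (todo : List (Alg L)) (𝒜 : Finset (Alg L)) (A : Alg L) (m : ℕ) :
      (¬ ∃ _ : Nonempty (L.Term (Fin m)), IsHomImage A (freeAlg (D : Set (Alg L)) (Fin m))) →
      Step (.free D todo 𝒜 A m) (.free D todo 𝒜 A (m + 1))
  /-- `SubPreHom(A, B)` finds a proper subalgebra `C` of `B` having `A` as a homomorphic
  image: `B ← C`. -/
  | smaller (D : Finset (Alg L)) (todo : List (Alg L)) (𝒜 : Finset (Alg L)) (A B : Alg L)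
      (C : L.Substructure B) (hC : (C : Set B).Nonempty) :
      C ≠ ⊤ → IsHomImage A (sub B C hC) →
      Step (.shrink D todo 𝒜 A B) (.shrink D todo 𝒜 A (sub B C hC))
  /-- `SubPreHom(A, B)` finds no such subalgebra: add `B` to `𝒜`. -/
  | add (D : Finset (Alg L)) (todo : List (Alg L)) (𝒜 : Finset (Alg L)) (A B : Alg L) :
      (¬ ∃ (C : L.Substructure B) (hC : (C : Set B).Nonempty),
        C ≠ ⊤ ∧ IsHomImage A (sub B C hC)) →
      Step (.shrink D todo 𝒜 A B) (.loop D todo (insert B 𝒜))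
  /-- All members of `D` are treated: call `MinGenSet(𝒜)`. -/
  | leave (D : Finset (Alg L)) (𝒜 : Finset (Alg L)) (l : List (Alg L)) :
      Lists l 𝒜 → Step (.loop D [] 𝒜) (.last (.scan [] l))
  | last (c c' : MGConfig L) : MGStep c c' → Step (.last c) (.last c')
  | finish (c : MGConfig L) (R : Finset (Alg L)) : MGReturns c R → Step (.last c) (.done R)

/-- `c` is an initial configuration of `AdmAlgs` on the input `K`. -/
def IsStart (K : Finset (Alg L)) (c : Config L) : Prop :=
  ∃ l : List (Alg L), Lists l K ∧ c = .first (.scan [] l)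

/-- `c` occurs in some run of `AdmAlgs` on the input `K`. -/
def Reachable (K : Finset (Alg L)) (c : Config L) : Prop :=
  ∃ c₀, IsStart K c₀ ∧ Relation.ReflTransGen Step c₀ c

/-- Some run of `AdmAlgs` on the input `K` returns `R`. -/
def AdmAlgsReturns (K R : Finset (Alg L)) : Prop := Reachable K (.done R)

/-- Every run of `AdmAlgs` on the input `K` ends after finitely many steps by returning a set: there
is a run, there is no infinite run, and a run can only stop by returning a set. -/
def AdmAlgsTerminates (K : Finset (Alg L)) : Prop :=
  (∃ c₀, IsStart K c₀) ∧
  (¬ ∃ r : ℕ → Config L, IsStart K (r 0) ∧ ∀ i, Step (r i) (r (i + 1))) ∧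
  ∀ c, Reachable K c → (∃ R, c = .done R) ∨ ∃ c', Step c c'

end AdmAlgs

end UAlg

/-!
Admissibility in `K` is validity in `F_K(ω)` (`valid_freeOmega_iff`), so a set of algebras captures
`K`-admissibility exactly if it generates `Q(F_K(ω))`, and the two halves of the theorem coincide
(`isOptimalForAdmissibility_iff`).

**Minimal generating sets.** Let `Q` be generated by a finite set of finite algebras. A
quasivariety generated by such a set `M` contains a finite algebra `A` only if homomorphisms from
`A` into members of `M` separate the points of `A` (`exists_hom_separating`). When the scan of
`MinGenSet` keeps `A`, some pair `a ≠ b` is identified by all non-injective homomorphisms from `A`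
into the list; if `S` is any other generating set, a homomorphism from `A` into a member of `S`
separating `a` and `b` must then be an embedding (`MGInv.next`). When the scan splits `A`, then
`A` is a subdirect product of the quotients that replace it and of quotients that embed into other
algebras of the list (`MGInv.split`). After pruning, the
result `R` is an antichain under embedding that generates `Q`, each of whose members embeds into a
member of every generating set `S`. Comparing, from the top, the sizes of the members of `R` with
those of the algebras of `S` into which they embed gives `R ≤_m S`, and equality of the multisets
forces these embeddings to be isomorphisms and to match `R` with `S`
(`IsEmbeddingAntichain.multisetLE`, `IsEmbeddingAntichain.sameUpToIso`).

**Admissibility.** The algebras collected by `AdmAlgs` embed into `F_K(ω)`, and their homomorphic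
images cover a generating set `D` of `Q(K)`. So they satisfy the same equations as `K`, and
substitutions show that every quasiequation valid in them is admissible: they generate `Q(F_K(ω))`
(`quasivariety_eq_freeOmega`).

**Termination.** A step of the scan replaces an algebra still to be treated by finitely many smaller
ones (`MGInv.acc`). The search for a free algebra stops because a finite `A ∈ D` is a homomorphic
image of `F_D(|A|)`, and the inner loop stops because `F_D(m)` is finite.
-/

namespace UAlg

open FirstOrder FirstOrder.Language

variable {L : FirstOrder.Language.{u, v}}

/-! ### Homomorphisms and embeddings -/

/-- The homomorphism from the term algebra determined by an assignment of the variables. -/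
def evalHom {X : Type} {A : Type u} [L.Structure A] (v : X → A) : L.Term X →[L] A where
  toFun := Term.realize v
  map_fun' _ _ := rfl
  map_rel' _ _ h := h.elim

@[simp]
theorem evalHom_var {X : Type} {A : Type u} [L.Structure A] (v : X → A) (x : X) :
    evalHom v (Term.var x : L.Term X) = v x := rfl

theorem termHom_ext {X : Type} {A : Type u} [L.Structure A] {g h : L.Term X →[L] A}
    (H : ∀ x, g (Term.var x) = h (Term.var x)) : g = h := by
  ext t
  induction t with
  | var x => exact H x
  | func f ts ih =>
    exact (g.map_fun f ts).trans ((congrArg _ (funext ih)).trans (h.map_fun f ts).symm)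

theorem exists_lift_of_surjective {X : Type} {A B : Type u} [L.Structure A] [L.Structure B]
    (p : B →[L] A) (hp : Function.Surjective p) (h : L.Term X →[L] A) :
    ∃ g : L.Term X →[L] B, ∀ t, p (g t) = h t := by
  refine ⟨evalHom fun x => Function.surjInv hp (h (Term.var x)), fun t => ?_⟩
  refine DFunLike.congr_fun (termHom_ext (g := p.comp (evalHom _)) (h := h) fun x => ?_) t
  exact Function.surjInv_eq hp _

/-- The kernel of a homomorphism. -/
def ker {A B : Type u} [L.Structure A] [L.Structure B] (f : A →[L] B) : Congruence L A where
  toSetoid := Setoid.ker f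
  map_rel g x y h := by
    change f _ = f _
    rw [f.map_fun, f.map_fun]
    exact congrArg _ (funext h)

theorem Embeds.trans {A B C : Alg L} : Embeds A B → Embeds B C → Embeds A C :=
  fun ⟨e⟩ ⟨f⟩ => ⟨f.comp e⟩

theorem embeds_sub (A : Alg L) (C : L.Substructure A) (hC : (C : Set A).Nonempty) :
    Embeds (sub A C hC) A := ⟨C.subtype⟩

theorem Embeds.finite {A B : Alg L} (h : Embeds A B) [Finite B] : Finite A := by
  obtain ⟨e⟩ := h
  exact Finite.of_injective e e.injective

theorem Embeds.card_le {A B : Alg L} (h : Embeds A B) [Finite B] :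
    Nat.card A ≤ Nat.card B := by
  obtain ⟨e⟩ := h
  exact Nat.card_le_card_of_injective e e.injective

theorem Iso.embeds {A B : Alg L} : Iso A B → Embeds A B := fun ⟨e⟩ => ⟨e.toEmbedding⟩

theorem Iso.symm {A B : Alg L} : Iso A B → Iso B A := fun ⟨e⟩ => ⟨e.symm⟩

theorem card_sub_lt {B : Alg L} [Finite B] {C : L.Substructure B} (hC : (C : Set B).Nonempty)
    (h : C ≠ ⊤) : Nat.card (sub B C hC) < Nat.card B := by
  refine (embeds_sub B C hC).card_le.lt_of_ne fun hc => h (eq_top_iff.2 fun b _ => ?_)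
  have hb := (Nat.bijective_iff_injective_and_card (fun x : sub B C hC => (x.1 : B))).2
    ⟨Subtype.val_injective, hc⟩
  obtain ⟨x, rfl⟩ := hb.2 b
  exact x.2

/-! ### Quasivarieties -/

theorem valid_iff_forall_singleton {K : Set (Alg L)} {q : QuasiEquation L} :
    Valid K q ↔ ∀ A ∈ K, Valid {A} q :=
  ⟨fun h A hA B hB => by rw [Set.mem_singleton_iff.1 hB]; exact h A hA,
    fun h A hA => h A hA A rfl⟩

theorem mem_quasivariety {K : Set (Alg L)} {A : Alg L} :
    A ∈ quasivariety K ↔ ∀ q, Valid K q → Valid {A} q := by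
  constructor
  · intro hA
    exact hA {B | ∀ q ∈ {q | Valid K q}, Valid {B} q} ⟨_, fun _ => Iff.rfl⟩
      fun B hB q hq => valid_iff_forall_singleton.1 hq B hB
  · rintro h C ⟨Λ, hΛ⟩ hKC
    exact (hΛ A).2 fun q hq => h q <|
      valid_iff_forall_singleton.2 fun B hB => (hΛ B).1 (hKC hB) q hq

theorem subset_quasivariety (K : Set (Alg L)) : K ⊆ quasivariety K :=
  (quasivariety_isLeast K).1.2

theorem quasivariety_subset_iff {K K' : Set (Alg L)} :
    quasivariety K ⊆ quasivariety K' ↔ ∀ A ∈ K, A ∈ quasivariety K' :=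
  ⟨fun h _ hA => h (subset_quasivariety K hA),
    fun h => (quasivariety_isLeast K).2 ⟨(quasivariety_isLeast K').1.1, h⟩⟩

theorem valid_of_mem_quasivariety {K : Set (Alg L)} {q : QuasiEquation L} :
    Valid (quasivariety K) q ↔ Valid K q :=
  ⟨fun h A hA => h A (subset_quasivariety K hA),
    fun h => valid_iff_forall_singleton.2 fun _ hA => mem_quasivariety.1 hA q h⟩

theorem quasivariety_eq_iff {K K' : Set (Alg L)} :
    quasivariety K = quasivariety K' ↔ ∀ q, Valid K q ↔ Valid K' q := by
  constructor
  · intro h q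
    rw [← valid_of_mem_quasivariety, h, valid_of_mem_quasivariety]
  · intro h
    ext A
    simp only [mem_quasivariety, h]

theorem mem_quasivariety_of_separates {K : Set (Alg L)} {A : Alg L}
    (H : ∀ a b : A, a ≠ b → ∃ C ∈ K, ∃ f : A →[L] C, f a ≠ f b) : A ∈ quasivariety K := by
  refine mem_quasivariety.2 fun q hq B hB h hp => ?_
  rw [Set.mem_singleton_iff] at hB
  subst hB
  by_contra hne
  obtain ⟨C, hC, f, hf⟩ := H _ _ hne
  exact hf (hq C hC (f.comp h) fun e he => congrArg f (hp e he))

theorem Embeds.mem_quasivariety {K : Set (Alg L)} {A B : Alg L} (h : Embeds A B)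
    (hB : B ∈ quasivariety K) : A ∈ quasivariety K := by
  have hsub : quasivariety {B} ⊆ quasivariety K := quasivariety_subset_iff.2 fun C hC => by
    rwa [Set.mem_singleton_iff.1 hC]
  obtain ⟨e⟩ := h
  exact hsub (mem_quasivariety_of_separates fun a b hab =>
    ⟨B, rfl, e.toHom, fun h => hab (e.injective h)⟩)

theorem validEq_iff_valid {K : Set (Alg L)} {e : Equation L} :
    ValidEq K e ↔ Valid K ⟨∅, e⟩ := by
  simp [ValidEq, Valid]

theorem validEq_of_isHomImage {K K' : Set (Alg L)} (H : ∀ A ∈ K', ∃ B ∈ K, IsHomImage A B)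
    {e : Equation L} (he : ValidEq K e) : ValidEq K' e := by
  intro A hA h
  obtain ⟨B, hB, p, hp⟩ := H A hA
  obtain ⟨g, hg⟩ := exists_lift_of_surjective p hp h
  rw [← hg, ← hg, he B hB g]

/-! ### Quotients -/

section Algebraic

variable [L.IsAlgebraic]

/-- The canonical homomorphism `A → A / θ`. -/
def quotHom (A : Alg L) (θ : Congruence L A) : A →[L] quot A θ :=
  letI := θ.prestructure
  { toFun := Quotient.mk θ.toSetoid
    map_fun' := fun f x => (funMap_quotient_mk' θ.toSetoid f x).symm
    map_rel' := fun r => isEmptyElim r }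

theorem quotHom_surjective (A : Alg L) (θ : Congruence L A) :
    Function.Surjective (quotHom A θ) := Quotient.mk_surjective

theorem quotHom_eq_iff {A : Alg L} {θ : Congruence L A} {a b : A} :
    quotHom A θ a = quotHom A θ b ↔ θ.toSetoid a b := Quotient.eq

/-- The homomorphism on `A / θ` induced by a homomorphism whose kernel contains `θ`. -/
def quotLift {A B : Alg L} (θ : Congruence L A) (f : A →[L] B)
    (hf : ∀ a b, θ.toSetoid a b → f a = f b) : quot A θ →[L] B where
  toFun := Quotient.lift f hf
  map_fun' {n} g x := by
    choose y hy using fun i => quotHom_surjective A θ (x i)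
    obtain rfl : (fun i => quotHom A θ (y i)) = x := funext hy
    have h := (quotHom A θ).map_fun g y
    exact (congrArg (Quotient.lift f hf) h.symm).trans (f.map_fun g y)
  map_rel' r := isEmptyElim r

theorem quotLift_quotHom {A B : Alg L} (θ : Congruence L A) (f : A →[L] B)
    (hf : ∀ a b, θ.toSetoid a b → f a = f b) (a : A) :
    quotLift θ f hf (quotHom A θ a) = f a := rfl

theorem embeds_quot_iff {A B : Alg L} {θ : Congruence L A} :
    Embeds (quot A θ) B ↔ ∃ f : A →[L] B, ∀ a b, f a = f b ↔ θ.toSetoid a b := by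
  constructor
  · rintro ⟨e⟩
    refine ⟨e.toHom.comp (quotHom A θ), fun a b => ?_⟩
    exact e.injective.eq_iff.trans quotHom_eq_iff
  · rintro ⟨f, hf⟩
    refine ⟨Embedding.ofInjective (f := quotLift θ f fun a b => (hf a b).2) fun x y => ?_⟩
    obtain ⟨a, rfl⟩ := quotHom_surjective A θ x
    obtain ⟨b, rfl⟩ := quotHom_surjective A θ y
    rw [quotLift_quotHom, quotLift_quotHom, quotHom_eq_iff]
    exact (hf a b).1

theorem Embeds.iso_of_card_eq {A B : Alg L} (h : Embeds A B) [Finite B]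
    (hc : Nat.card A = Nat.card B) : Iso A B := by
  obtain ⟨e⟩ := h
  have : Finite A := Finite.of_injective e e.injective
  have hb : Function.Bijective e := (Nat.bijective_iff_injective_and_card e).2 ⟨e.injective, hc⟩
  exact ⟨{ Equiv.ofBijective e hb with
    map_fun' := fun f x => e.map_fun f x
    map_rel' := fun r => isEmptyElim r }⟩

theorem finite_quot {A : Alg L} [Finite A] (θ : Congruence L A) : Finite (quot A θ) :=
  Finite.of_surjective _ (quotHom_surjective A θ)

theorem card_quot_lt {A : Alg L} [Finite A] {θ : Congruence L A} (h : θ.toSetoid ≠ ⊥) :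
    Nat.card (quot A θ) < Nat.card A := by
  refine (Nat.card_le_card_of_surjective _ (quotHom_surjective A θ)).lt_of_ne fun hc => h ?_
  have hb := (Nat.bijective_iff_surjective_and_card (quotHom A θ)).2
    ⟨quotHom_surjective A θ, hc.symm⟩
  exact eq_bot_iff.2 fun {a b} hab => hb.1 (quotHom_eq_iff.2 hab)

instance finite_congruence {A : Alg L} [Finite A] : Finite (Congruence L A) := by
  refine Finite.of_injective (fun θ => (θ.toSetoid.r : A → A → Prop)) ?_
  rintro ⟨s, hs⟩ ⟨t, ht⟩ h
  obtain rfl : s = t := Setoid.ext fun a b => iff_of_eq (congrFun (congrFun h a) b)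
  rfl

/-! ### Finite algebras in a finitely generated quasivariety -/

/-- Only finitely many maps from `A` into members of `M` have to be excluded as homomorphisms, so a
finite part of the diagram of `A` suffices as the premise of a quasiequation; hence no ultraproducts
are needed to see that finite members of the quasivariety lie in `ISP(M)`. -/
theorem exists_hom_separating {M : Finset (Alg L)} (hM : FinAlgs M) {A : Alg L} [Finite A]
    (hA : A ∈ quasivariety (M : Set (Alg L))) {a b : A} (hab : a ≠ b) :
    ∃ C ∈ M, ∃ f : A →[L] C, f a ≠ f b := by
  classical
  by_contra! hno
  obtain ⟨ι, hι⟩ := Countable.exists_injective_nat A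
  have hr : ∀ x, Function.invFun ι (ι x) = x := Function.leftInverse_invFun hι
  have key : ∀ p : Σ C : M, A → C.1, ∃ e : Equation L,
      evalHom (Function.invFun ι) e.1 = evalHom (Function.invFun ι) e.2 ∧
      (p.2 a ≠ p.2 b → ∀ h : L.Term ℕ →[L] p.1.1, (∀ x, h (Term.var (ι x)) = p.2 x) →
        h e.1 ≠ h e.2) := by
    rintro ⟨⟨C, hC⟩, g⟩
    by_cases hg : ∃ (n : ℕ) (f : L.Functions n) (x : Fin n → A),
        g (Structure.funMap f x) ≠ Structure.funMap f (g ∘ x)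
    · obtain ⟨n, f, x, hx⟩ := hg
      refine ⟨(Term.var (ι (Structure.funMap f x)), Term.func f fun i => Term.var (ι (x i))),
        ?_, fun _ h hh heq => hx ?_⟩
      · change Function.invFun ι _ = Structure.funMap f fun i => Function.invFun ι (ι (x i))
        simp only [hr]
      · exact (hh _).symm.trans <| heq.trans <|
          (h.map_fun f _).trans (congrArg _ (funext fun i => hh (x i)))
    · push Not at hg
      refine ⟨(Term.var 0, Term.var 0), rfl, fun hne => (hne ?_).elim⟩
      exact hno C hC { toFun := g, map_fun' := fun f x => hg _ f x,
                       map_rel' := fun r => isEmptyElim r }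
  choose E hE₁ hE₂ using key
  have : ∀ C : M, Finite C.1 := fun C => hM C.1 C.2
  have := Fintype.ofFinite (Σ C : M, A → C.1)
  let q : QuasiEquation L := ⟨Finset.univ.image E, (Term.var (ι a), Term.var (ι b))⟩
  have hq : Valid (M : Set (Alg L)) q := by
    intro C hC h hp
    by_contra hne
    exact hE₂ ⟨⟨C, hC⟩, fun x => h (Term.var (ι x))⟩ hne h (fun _ => rfl)
      (hp _ (Finset.mem_image_of_mem E (Finset.mem_univ _)))
  have := mem_quasivariety.1 hA q hq A rfl (evalHom (Function.invFun ι)) fun e he => by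
    obtain ⟨p, -, rfl⟩ := Finset.mem_image.1 he
    exact hE₁ p
  change Function.invFun ι (ι a) = Function.invFun ι (ι b) at this
  rw [hr, hr] at this
  exact hab this

/-! ### Free algebras and admissibility -/

theorem freeCongruence_iff {K : Set (Alg L)} {X : Type} [Nonempty (L.Term X)] {s t : L.Term X} :
    (freeCongruence K X).toSetoid s t ↔ ∀ A ∈ K, ∀ h : L.Term X →[L] A, h s = h t := by
  constructor
  · intro hst A hA h
    exact hst (ker (A := termAlg L X) h).toSetoid
      ⟨_, rfl, A, hA, (embeds_quot_iff (A := termAlg L X)).2 ⟨h, fun _ _ => Iff.rfl⟩⟩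
  · rintro H _ ⟨φ, rfl, A, hA, hφ⟩
    obtain ⟨f, hf⟩ := embeds_quot_iff.1 hφ
    exact (hf s t).1 (H A hA f)

/-- The canonical homomorphism from the term algebra to the free algebra. -/
def freeHom (K : Set (Alg L)) (X : Type) [Nonempty (L.Term X)] : L.Term X →[L] freeAlg K X :=
  quotHom (termAlg L X) (freeCongruence K X)

theorem freeHom_surjective (K : Set (Alg L)) (X : Type) [Nonempty (L.Term X)] :
    Function.Surjective (freeHom K X) := quotHom_surjective (termAlg L X) _

theorem freeHom_eq_iff {K : Set (Alg L)} {X : Type} [Nonempty (L.Term X)] {s t : L.Term X} :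
    freeHom K X s = freeHom K X t ↔ ∀ A ∈ K, ∀ h : L.Term X →[L] A, h s = h t :=
  (quotHom_eq_iff (A := termAlg L X)).trans freeCongruence_iff

theorem isHomImage_freeAlg {K : Set (Alg L)} {X : Type} [Nonempty (L.Term X)] {A : Alg L}
    (hA : A ∈ K) (v : X → A) (hv : Function.Surjective v) : IsHomImage A (freeAlg K X) := by
  refine ⟨quotLift (A := termAlg L X) _ (evalHom v) fun s t hst =>
    freeCongruence_iff.1 hst A hA _, fun a => ?_⟩
  obtain ⟨x, rfl⟩ := hv a
  exact ⟨freeHom K X (Term.var x), rfl⟩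

theorem exists_isHomImage_freeAlg {K : Set (Alg L)} {A : Alg L} [Finite A] (hA : A ∈ K) :
    ∃ m, ∃ _ : Nonempty (L.Term (Fin m)), IsHomImage A (freeAlg K (Fin m)) := by
  let e := Finite.equivFin A
  have : Nonempty (L.Term (Fin (Nat.card A))) := A.nonempty.map fun a => Term.var (e a)
  exact ⟨Nat.card A, this, isHomImage_freeAlg hA e.symm e.symm.surjective⟩

/-- A term over `X` is determined, up to equality in the free algebra, by its values under the
finitely many assignments of `X` in members of `K`. -/
theorem finite_freeAlg {K : Finset (Alg L)} (hK : FinAlgs K) {X : Type} [Finite X]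
    [Nonempty (L.Term X)] : Finite (freeAlg (K : Set (Alg L)) X) := by
  have : ∀ C : K, Finite C.1 := fun C => hK C.1 C.2
  refine Finite.of_injective
    (fun x (C : K) (v : X → C.1) =>
      evalHom v (Function.surjInv (freeHom_surjective (K : Set (Alg L)) X) x))
    fun x y hxy => ?_
  rw [← Function.surjInv_eq (freeHom_surjective (K : Set (Alg L)) X) x,
    ← Function.surjInv_eq (freeHom_surjective (K : Set (Alg L)) X) y]
  refine freeHom_eq_iff.2 fun A hA h => ?_
  have hh : evalHom (fun x => h (Term.var x)) = h := termHom_ext fun _ => rfl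
  have := congrFun (congrFun hxy ⟨A, hA⟩) fun x => h (Term.var x)
  dsimp only at this
  rwa [hh] at this

theorem freeAlg_fin_embeds_freeOmega (K : Set (Alg L)) (m : ℕ) [Nonempty (L.Term (Fin m))] :
    Embeds (freeAlg K (Fin m)) (freeOmega K) := by
  refine embeds_quot_iff.2
    ⟨(freeHom K ℕ).comp (evalHom fun i : Fin m => (Term.var i.1 : L.Term ℕ)), fun s t => ?_⟩
  refine freeHom_eq_iff.trans (Iff.trans ?_ freeCongruence_iff.symm)
  constructor
  · intro H A hA h
    let a : A := Classical.choice A.nonempty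
    let g : L.Term ℕ →[L] A := evalHom fun n =>
      if hn : n < m then h (Term.var ⟨n, hn⟩) else a
    have hg : h = g.comp (evalHom fun i : Fin m => (Term.var i.1 : L.Term ℕ)) :=
      termHom_ext fun i => by simp [g]
    rw [hg]
    exact H A hA g
  · intro H A hA h
    exact H A hA (h.comp (evalHom fun i : Fin m => (Term.var i.1 : L.Term ℕ)))

theorem freeHom_nat_eq_iff {K : Set (Alg L)} {e : Equation L} :
    freeHom K ℕ e.1 = freeHom K ℕ e.2 ↔ ValidEq K e := freeHom_eq_iff

/-- Homomorphisms `Tm → F_K(ω)` lift to substitutions, and equality in `F_K(ω)` is `K`-validity. -/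
theorem valid_freeOmega_iff {K : Set (Alg L)} {q : QuasiEquation L} :
    Valid {freeOmega K} q ↔ Admissible K q := by
  constructor
  · intro H σ hσ
    exact freeHom_nat_eq_iff.1 <|
      H _ rfl ((freeHom K ℕ).comp σ) fun e he => freeHom_nat_eq_iff.2 (hσ e he)
  · intro H B hB h hp
    rw [Set.mem_singleton_iff] at hB
    subst hB
    obtain ⟨σ, hσ⟩ := exists_lift_of_surjective (freeHom K ℕ) (freeHom_surjective K ℕ) h
    have := H σ fun e he => freeHom_nat_eq_iff.1 <|
      (hσ _).trans ((hp e he).trans (hσ _).symm)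
    exact (hσ _).symm.trans ((freeHom_nat_eq_iff.2 this).trans (hσ _))

theorem capturesAdmissibility_iff {K R : Set (Alg L)} :
    CapturesAdmissibility K R ↔ quasivariety R = quasivariety {freeOmega K} := by
  rw [quasivariety_eq_iff]
  exact forall_congr' fun q => by rw [valid_freeOmega_iff]; exact Iff.comm

theorem isOptimalForAdmissibility_iff {K : Set (Alg L)} {R : Finset (Alg L)} :
    IsOptimalForAdmissibility K R ↔ IsMinGenSet (quasivariety {freeOmega K}) R := by
  simp only [IsOptimalForAdmissibility, IsMinGenSet, capturesAdmissibility_iff]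

theorem freeOmega_congr {K K' : Set (Alg L)} (h : quasivariety K = quasivariety K') :
    freeOmega K = freeOmega K' := by
  have hs : (freeCongruence K ℕ).toSetoid = (freeCongruence K' ℕ).toSetoid :=
    Setoid.ext fun s t => by
      have := quasivariety_eq_iff.1 h ⟨∅, (s, t)⟩
      rw [← validEq_iff_valid, ← validEq_iff_valid] at this
      exact freeCongruence_iff.trans (this.trans freeCongruence_iff.symm)
  have : freeCongruence K ℕ = freeCongruence K' ℕ := by
    revert hs
    cases freeCongruence K ℕ
    cases freeCongruence K' ℕ
    rintro rfl
    rfl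
  rw [freeOmega, freeOmega, freeAlg, freeAlg, this]

/-- A class of algebras in `Q(F_D(ω))` whose homomorphic images cover `D` has the same equations as
`D`, hence the same free algebra `F_D(ω)`, which lies in the quasivariety of that class. -/
theorem quasivariety_eq_freeOmega {D 𝒜 : Set (Alg L)}
    (hsub : ∀ B ∈ 𝒜, B ∈ quasivariety {freeOmega D})
    (himg : ∀ A ∈ D, ∃ B ∈ 𝒜, IsHomImage A B) :
    quasivariety 𝒜 = quasivariety {freeOmega D} := by
  refine (quasivariety_subset_iff.2 hsub).antisymm (quasivariety_subset_iff.2 fun F hF => ?_)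
  rw [Set.mem_singleton_iff] at hF
  subst hF
  refine mem_quasivariety.2 fun q hq => valid_freeOmega_iff.2 fun σ hσ => ?_
  have hD : ∀ e : Equation L, ValidEq D e → ValidEq 𝒜 e := by
    intro e he B hB
    have : Valid {freeOmega D} ⟨∅, e⟩ := valid_freeOmega_iff.2 fun τ _ A hA h =>
      he A hA (h.comp τ)
    exact validEq_iff_valid.2 (mem_quasivariety.1 (hsub B hB) _ this) B rfl
  exact validEq_of_isHomImage himg fun B hB h =>
    hq B hB (h.comp σ) fun e he => hD _ (hσ e he) B hB h

end Algebraic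

/-! ### Embedding antichains and the multiset ordering -/

/-- No member of `M` embeds into a different member. -/
def IsEmbeddingAntichain (M : Finset (Alg L)) : Prop :=
  ∀ A ∈ M, ∀ B ∈ M, Embeds A B → A = B

open Classical in
theorem count_sizes (M : Finset (Alg L)) (x : ℕ) :
    (sizes M).count x = (M.filter fun A : Alg L => x = Nat.card A).card :=
  Multiset.count_map _ _ _

theorem exists_embedding_choice {M S : Finset (Alg L)}
    (h : ∀ A ∈ M, ∃ B ∈ S, Embeds A B) :
    ∃ f : Alg L → Alg L, ∀ A ∈ M, f A ∈ S ∧ Embeds A (f A) := by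
  have : ∀ A, ∃ B, A ∈ M → B ∈ S ∧ Embeds A B := fun A => by
    by_cases hA : A ∈ M
    · obtain ⟨B, hB⟩ := h A hA
      exact ⟨B, fun _ => hB⟩
    · exact ⟨A, fun h => (hA h).elim⟩
  choose f hf using this
  exact ⟨f, hf⟩

section Antichain

variable [L.IsAlgebraic] {M S : Finset (Alg L)} {f : Alg L → Alg L}

theorem IsEmbeddingAntichain.eq_of_image_eq (hM : IsEmbeddingAntichain M) (hS : FinAlgs S)
    (hf : ∀ A ∈ M, f A ∈ S ∧ Embeds A (f A)) {A A' : Alg L} (hA : A ∈ M) (hA' : A' ∈ M)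
    (hc : Nat.card (f A) = Nat.card A) (h : f A = f A') : A' = A := by
  have : Finite (f A) := hS _ (hf A hA).1
  have hiso := (hf A hA).2.iso_of_card_eq hc.symm
  have h' := (hf A' hA').2
  rw [← h] at h'
  exact hM A' hA' A hA (h'.trans hiso.symm.embeds)

theorem IsEmbeddingAntichain.count_sizes_le (hM : IsEmbeddingAntichain M) (hS : FinAlgs S)
    (hf : ∀ A ∈ M, f A ∈ S ∧ Embeds A (f A)) {x : ℕ}
    (hx : ∀ A ∈ M, Nat.card A = x → Nat.card (f A) = x) :
    (sizes M).count x ≤ (sizes S).count x := by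
  classical
  rw [count_sizes, count_sizes]
  refine Finset.card_le_card_of_injOn f (fun A hA => ?_) fun A hA A' hA' h => ?_
  · obtain ⟨hAM, rfl⟩ := Finset.mem_filter.1 hA
    exact Finset.mem_filter.2 ⟨(hf A hAM).1, (hx A hAM rfl).symm⟩
  · obtain ⟨hAM, rfl⟩ := Finset.mem_filter.1 hA
    exact (hM.eq_of_image_eq hS hf hAM (Finset.mem_filter.1 hA').1 (hx A hAM rfl) h).symm

theorem IsEmbeddingAntichain.count_sizes_lt (hM : IsEmbeddingAntichain M) (hS : FinAlgs S)
    (hf : ∀ A ∈ M, f A ∈ S ∧ Embeds A (f A)) {B : Alg L} (hB : B ∈ S)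
    (hx : ∀ A ∈ M, Nat.card A = Nat.card B → Nat.card (f A) = Nat.card B ∧ f A ≠ B) :
    (sizes M).count (Nat.card B) < (sizes S).count (Nat.card B) := by
  classical
  have hle : (sizes M).count (Nat.card B) ≤ (sizes (S.erase B)).count (Nat.card B) := by
    rw [count_sizes, count_sizes]
    refine Finset.card_le_card_of_injOn f (fun A hA => ?_) fun A hA A' hA' h => ?_
    · obtain ⟨hAM, hc⟩ := Finset.mem_filter.1 hA
      have := hx A hAM hc.symm
      exact Finset.mem_filter.2 ⟨Finset.mem_erase.2 ⟨this.2, (hf A hAM).1⟩, this.1.symm⟩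
    · obtain ⟨hAM, hc⟩ := Finset.mem_filter.1 hA
      exact (hM.eq_of_image_eq hS hf hAM (Finset.mem_filter.1 hA').1
        ((hx A hAM hc.symm).1.trans hc) h).symm
  refine hle.trans_lt ?_
  rw [count_sizes, count_sizes, Finset.filter_erase]
  exact Finset.card_erase_lt_of_mem (Finset.mem_filter.2 ⟨hB, rfl⟩)

/-- Among the members of `M` that `f` maps to larger algebras take one of maximal size; the size of
its image is the required `y`. -/
theorem IsEmbeddingAntichain.exists_count_sizes_lt (hM : IsEmbeddingAntichain M) (hS : FinAlgs S)
    (hf : ∀ A ∈ M, f A ∈ S ∧ Embeds A (f A)) {A : Alg L} (hA : A ∈ M)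
    (hc : Nat.card (f A) ≠ Nat.card A) :
    ∃ y, Nat.card A < y ∧ (sizes M).count y < (sizes S).count y ∧
      ∀ z, y < z → (sizes M).count z ≤ (sizes S).count z := by
  classical
  obtain ⟨A₀, hA₀, hmax⟩ := Finset.exists_max_image
    (M.filter fun A => Nat.card (f A) ≠ Nat.card A) (fun A => Nat.card A)
    ⟨A, Finset.mem_filter.2 ⟨hA, hc⟩⟩
  obtain ⟨hA₀, hc₀⟩ := Finset.mem_filter.1 hA₀
  have hgood : ∀ B ∈ M, Nat.card A₀ < Nat.card B → Nat.card (f B) = Nat.card B := by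
    intro B hB hlt
    by_contra hne
    exact hlt.not_ge (hmax B (Finset.mem_filter.2 ⟨hB, hne⟩))
  have : Finite (f A₀) := hS _ (hf A₀ hA₀).1
  have hlt : Nat.card A₀ < Nat.card (f A₀) := (hf A₀ hA₀).2.card_le.lt_of_ne' hc₀
  refine ⟨Nat.card (f A₀), (hmax A (Finset.mem_filter.2 ⟨hA, hc⟩)).trans_lt hlt,
    hM.count_sizes_lt hS hf (hf A₀ hA₀).1 fun B hB hBc => ?_, fun z hz =>
    hM.count_sizes_le hS hf fun B hB hBc => ?_⟩
  · have hBg := hgood B hB (hBc ▸ hlt)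
    refine ⟨hBg.trans hBc, fun heq => hc₀ ?_⟩
    rw [hM.eq_of_image_eq hS hf hB hA₀ hBg heq, hBg]
  · rw [← hBc]
    exact hgood B hB (hBc ▸ hlt.trans hz)

theorem IsEmbeddingAntichain.multisetLE (hM : IsEmbeddingAntichain M) (hS : FinAlgs S)
    (h : ∀ A ∈ M, ∃ B ∈ S, Embeds A B) : MultisetLE (sizes M) (sizes S) := by
  obtain ⟨f, hf⟩ := exists_embedding_choice h
  intro x hx
  obtain ⟨A, hA, rfl, hc⟩ : ∃ A ∈ M, Nat.card A = x ∧ Nat.card (f A) ≠ x := by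
    by_contra! hno
    exact hx.not_ge (hM.count_sizes_le hS hf hno)
  obtain ⟨y, hy, hlt, -⟩ := hM.exists_count_sizes_lt hS hf hA hc
  exact ⟨y, hy, hlt⟩

/-- If the multiset of sizes of `S` is at most that of `M`, then an embedding of each `A ∈ M` into
some `f A ∈ S` is forced to preserve the size, and `f` to be a bijection. -/
theorem IsEmbeddingAntichain.sameUpToIso (hM : IsEmbeddingAntichain M) (hS : FinAlgs S)
    (h : ∀ A ∈ M, ∃ B ∈ S, Embeds A B) (hle : MultisetLE (sizes S) (sizes M)) :
    SameUpToIso M S := by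
  obtain ⟨f, hf⟩ := exists_embedding_choice h
  have hgood : ∀ A ∈ M, Nat.card (f A) = Nat.card A := by
    intro A hA
    by_contra hc
    obtain ⟨y, -, hlt, htop⟩ := hM.exists_count_sizes_lt hS hf hA hc
    obtain ⟨z, hz, hzlt⟩ := hle y hlt
    exact hzlt.not_ge (htop z hz)
  have hcount : ∀ x, (sizes M).count x ≤ (sizes S).count x := fun x =>
    hM.count_sizes_le hS hf fun A hA hx => (hgood A hA).trans hx
  have hsurj : ∀ B ∈ S, ∃ A ∈ M, f A = B := by
    intro B hB
    by_contra! hno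
    obtain ⟨z, -, hz⟩ := hle _ <| hM.count_sizes_lt hS hf hB fun A hA hx =>
      ⟨(hgood A hA).trans hx, hno A hA⟩
    exact hz.not_ge (hcount z)
  refine ⟨Equiv.ofBijective (fun A => ⟨f A.1, (hf A.1 A.2).1⟩) ⟨fun A A' hAA' => ?_, fun B => ?_⟩,
    fun A => ?_⟩
  · exact Subtype.ext
      (hM.eq_of_image_eq hS hf A.2 A'.2 (hgood _ A.2) (congrArg Subtype.val hAA')).symm
  · obtain ⟨A, hA, hAB⟩ := hsurj B.1 B.2
    exact ⟨⟨A, hA⟩, Subtype.ext hAB⟩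
  · have : Finite (f A.1) := hS _ (hf A.1 A.2).1
    exact (hf A.1 A.2).2.iso_of_card_eq (hgood A.1 A.2).symm

end Antichain

/-! ### Correctness of `MinGenSet` -/

/-- `A` embeds into a member of every finite set of finite algebras generating `Q`. If `Q` is
finitely generated, finite members of `Q` that are subdirectly irreducible relative to `Q` have this
property; it is the only consequence of irreducibility that is needed. -/
def EmbedsInGenerators (Q : Set (Alg L)) (A : Alg L) : Prop :=
  ∀ S : Finset (Alg L), FinAlgs S → quasivariety (S : Set (Alg L)) = Q → ∃ B ∈ S, Embeds A B

/-- What `MinGenSet` guarantees about the set it returns. -/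
structure IsReducedGenSet (Q : Set (Alg L)) (R : Finset (Alg L)) : Prop where
  finAlgs : FinAlgs R
  quasivariety_eq : quasivariety (R : Set (Alg L)) = Q
  antichain : IsEmbeddingAntichain R
  embeds : ∀ A ∈ R, EmbedsInGenerators Q A

theorem IsReducedGenSet.isMinGenSet [L.IsAlgebraic] {Q : Set (Alg L)} {R : Finset (Alg L)}
    (h : IsReducedGenSet Q R) : IsMinGenSet Q R :=
  ⟨h.finAlgs, h.quasivariety_eq, fun S hS hSQ =>
    h.antichain.multisetLE hS fun A hA => h.embeds A hA S hS hSQ⟩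

theorem IsReducedGenSet.sameUpToIso [L.IsAlgebraic] {Q : Set (Alg L)} {R S : Finset (Alg L)}
    (h : IsReducedGenSet Q R) (hS : IsMinGenSet Q S) : SameUpToIso R S :=
  h.antichain.sameUpToIso hS.1 (fun A hA => h.embeds A hA S hS.1 hS.2.1)
    (hS.2.2 R h.finAlgs h.quasivariety_eq)

/-- The invariant of `MinGenSet`: the current list consists of finite algebras and generates `Q`,
and whatever has been kept embeds into a member of every finite generating set; in the final loop,
moreover, the algebras kept so far embed neither into each other nor into later ones. -/
def MGInv (Q : Set (Alg L)) : MGConfig L → Prop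
  | .scan done todo => (∀ A ∈ done ++ todo, Finite A) ∧
      quasivariety {A | A ∈ done ++ todo} = Q ∧ ∀ A ∈ done, EmbedsInGenerators Q A
  | .prune kept todo => (∀ A ∈ kept ++ todo, Finite A) ∧
      quasivariety {A | A ∈ kept ++ todo} = Q ∧ (∀ A ∈ kept ++ todo, EmbedsInGenerators Q A) ∧
      kept.Pairwise (fun A B => ¬ Embeds A B ∧ ¬ Embeds B A) ∧
      ∀ A ∈ kept, ∀ B ∈ todo, ¬ Embeds A B

theorem meet_eq_bot_iff {A : Alg L} {T : Set (Congruence L A)} :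
    meet T = ⊥ ↔ ∀ a b : A, a ≠ b → ∃ θ ∈ T, ¬ θ.toSetoid a b := by
  constructor
  · intro h a b hab
    by_contra! hno
    have : meet T a b := by
      rintro _ ⟨θ, hθ, rfl⟩
      exact hno θ hθ
    rw [h] at this
    exact hab this
  · intro h
    refine eq_bot_iff.2 fun {a b} hab => ?_
    by_contra hne
    obtain ⟨θ, hθ, hn⟩ := h a b hne
    exact hn (hab _ ⟨θ, hθ, rfl⟩)

theorem quasivariety_congr {P P' : Set (Alg L)} (h : ∀ A ∈ P, A ∈ quasivariety P')
    (h' : ∀ A ∈ P', A ∈ quasivariety P) : quasivariety P = quasivariety P' :=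
  (quasivariety_subset_iff.2 h).antisymm (quasivariety_subset_iff.2 h')

theorem mgInv_start {K : Finset (Alg L)} (hK : FinAlgs K) {l : List (Alg L)} (hl : Lists l K) :
    MGInv (quasivariety (K : Set (Alg L))) (.scan [] l) := by
  have hset : {A | A ∈ [] ++ l} = (K : Set (Alg L)) := Set.ext fun A => by simp [hl.2]
  exact ⟨fun A hA => hK A ((hl.2 A).1 (by simpa using hA)), by rw [hset], by simp⟩

theorem MGInv.isReducedGenSet {Q : Set (Alg L)} {c : MGConfig L} {R : Finset (Alg L)}
    (h : MGInv Q c) (hR : MGReturns c R) : IsReducedGenSet Q R := by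
  obtain ⟨kept, rfl, hmem⟩ := hR
  obtain ⟨hfin, hQ, hirr, hp, -⟩ := h
  simp only [List.append_nil, ← hmem] at hfin hQ hirr
  refine ⟨hfin, hQ, fun A hA B hB hAB => ?_, hirr⟩
  by_contra hne
  have hsymm : Std.Symm fun A B : Alg L => ¬ Embeds A B ∧ ¬ Embeds B A := ⟨fun _ _ h => h.symm⟩
  exact (hp.forall ((hmem A).1 hA) ((hmem B).1 hB) hne).1 hAB

section Algebraic

variable [L.IsAlgebraic]

/-- Replacing `A` by quotients keeps the quasivariety: `A` is a subdirect product of its quotients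
by `S₁ ∪ S₂`, each of which is appended or embeds into another algebra of the list. -/
theorem MGInv.split {Q : Set (Alg L)} {done todo : List (Alg L)} {A : Alg L}
    {ts : List (Congruence L A)} (h : MGInv Q (.scan done (A :: todo)))
    (hmeet : meet (S₁ A ∪ S₂ A (done ++ todo)) = ⊥)
    (hts : ∀ θ, θ ∈ ts ↔ θ ∈ S₁ A \ S₂ A (done ++ todo)) :
    MGInv Q (.scan done (todo ++ ts.map (quot A))) := by
  obtain ⟨hfin, hQ, hdone⟩ := h
  have hAf : Finite A := hfin A (by simp)
  refine ⟨fun B hB => ?_, hQ ▸ quasivariety_congr (fun B hB => ?_) (fun B hB => ?_), hdone⟩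
  · simp only [List.mem_append, List.mem_map] at hB
    rcases hB with hB | hB | ⟨θ, -, rfl⟩
    · exact hfin B (by simp [hB])
    · exact hfin B (by simp [hB])
    · exact finite_quot θ
  · simp only [List.mem_append, List.mem_map, Set.mem_ofPred_eq] at hB
    rcases hB with hB | hB | ⟨θ, hθ, rfl⟩
    · exact subset_quasivariety _ (by simp [hB])
    · exact subset_quasivariety _ (by simp [hB])
    · exact ((hts θ).1 hθ).1.2.mem_quasivariety (subset_quasivariety _ (by simp))
  · simp only [List.mem_append, List.mem_cons, Set.mem_ofPred_eq] at hB
    rcases hB with hB | rfl | hB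
    · exact subset_quasivariety _ (by simp [hB])
    · refine mem_quasivariety_of_separates fun a b hab => ?_
      obtain ⟨θ, hθ, hn⟩ := meet_eq_bot_iff.1 hmeet a b hab
      by_cases h2 : θ ∈ S₂ B (done ++ todo)
      · obtain ⟨-, C, hC, hemb⟩ := h2
        obtain ⟨f, hf⟩ := embeds_quot_iff.1 hemb
        refine ⟨C, ?_, f, fun he => hn ((hf a b).1 he)⟩
        simp only [List.mem_append] at hC
        rcases hC with hC | hC <;> simp [hC]
      · have h1 : θ ∈ S₁ B := hθ.resolve_right h2
        refine ⟨quot B θ, ?_, quotHom B θ, fun he => hn (quotHom_eq_iff.1 he)⟩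
        simp only [List.mem_append, List.mem_map, Set.mem_ofPred_eq]
        exact Or.inr (Or.inr ⟨θ, (hts θ).2 ⟨h1, h2⟩, rfl⟩)
    · exact subset_quasivariety _ (by simp [hB])

/-- If two points `a ≠ b` of `A` are identified by every non-injective homomorphism into the list,
then a homomorphism from `A` into a member of another generating set that separates `a` and `b` must
be injective: otherwise, followed by a homomorphism into the list that separates the images, it
would be non-injective. -/
theorem MGInv.next {Q : Set (Alg L)} {done todo : List (Alg L)} {A : Alg L}
    (h : MGInv Q (.scan done (A :: todo)))
    (hmeet : meet (S₁ A ∪ S₂ A (done ++ todo)) ≠ ⊥) :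
    MGInv Q (.scan (done ++ [A]) todo) := by
  classical
  obtain ⟨hfin, hQ, hdone⟩ := h
  have hlist : done ++ [A] ++ todo = done ++ A :: todo := by simp
  refine ⟨by rwa [hlist], by rwa [hlist], fun B hB => ?_⟩
  simp only [List.mem_append, List.mem_singleton] at hB
  rcases hB with hB | rfl
  · exact hdone B hB
  have hBmem : B ∈ done ++ B :: todo := by simp
  have hBf : Finite B := hfin B hBmem
  rw [Ne, meet_eq_bot_iff] at hmeet
  push Not at hmeet
  obtain ⟨a, b, hab, hall⟩ := hmeet
  have hnoninj : ∀ C ∈ done ++ B :: todo, ∀ f : B →[L] C, ¬ Function.Injective f → f a = f b := by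
    intro C hC f hf
    refine hall (ker f) ?_
    have hne : (ker f).toSetoid ≠ ⊥ := fun hk => hf fun x y hxy => by
      have : (ker f).toSetoid x y := hxy
      rwa [hk] at this
    have hemb : Embeds (quot B (ker f)) C := embeds_quot_iff.2 ⟨f, fun _ _ => Iff.rfl⟩
    simp only [List.mem_append, List.mem_cons] at hC
    rcases hC with hC | rfl | hC
    · exact Or.inr ⟨hne, C, by simp [hC], hemb⟩
    · exact Or.inl ⟨hne, hemb⟩
    · exact Or.inr ⟨hne, C, by simp [hC], hemb⟩
  intro S hS hSQ
  obtain ⟨C, hC, f, hf⟩ := exists_hom_separating hS (A := B)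
    (by rw [hSQ, ← hQ]; exact subset_quasivariety _ hBmem) hab
  refine ⟨C, hC, ?_⟩
  by_cases hinj : Function.Injective f
  · exact ⟨Embedding.ofInjective hinj⟩
  have hCf : Finite C := hS C hC
  obtain ⟨E, hE, g, hg⟩ := exists_hom_separating (M := (done ++ B :: todo).toFinset)
    (fun E hE => hfin E (List.mem_toFinset.1 hE)) (A := C)
    (by
      rw [List.coe_toFinset, hQ, ← hSQ]
      exact subset_quasivariety _ hC) hf
  refine (hg (hnoninj E (List.mem_toFinset.1 hE) (g.comp f) fun hgf => hinj ?_)).elim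
  exact Function.Injective.of_comp (f := g) hgf

theorem MGInv.step {Q : Set (Alg L)} {c c' : MGConfig L} (h : MGInv Q c) (hs : MGStep c c') :
    MGInv Q c' := by
  cases hs with
  | split done todo A ts hmeet _ hts => exact h.split hmeet hts
  | next done todo A hmeet => exact h.next hmeet
  | scanned done =>
    obtain ⟨hfin, hQ, hdone⟩ := h
    simp only [List.append_nil] at hfin hQ
    exact ⟨by simpa using hfin, by simpa using hQ, by simpa using hdone, List.Pairwise.nil,
      by simp⟩
  | drop kept todo A hA =>
    obtain ⟨hfin, hQ, hirr, hp, hkt⟩ := h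
    have hsub : ∀ B ∈ kept ++ todo, B ∈ kept ++ A :: todo := fun B hB => by
      simp only [List.mem_append, List.mem_cons] at hB ⊢
      tauto
    refine ⟨fun B hB => hfin B (hsub B hB), hQ ▸ quasivariety_congr
      (fun B hB => subset_quasivariety _ (hsub B hB)) (fun B hB => ?_),
      fun B hB => hirr B (hsub B hB), hp, fun B hB C hC => hkt B hB C (by simp [hC])⟩
    obtain ⟨C, hC, hAC⟩ := hA
    simp only [List.mem_append, List.mem_cons, Set.mem_ofPred_eq] at hB
    rcases hB with hB | rfl | hB
    · exact subset_quasivariety _ (by simp [hB])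
    · exact hAC.mem_quasivariety (subset_quasivariety _ hC)
    · exact subset_quasivariety _ (by simp [hB])
  | keep kept todo A hA =>
    obtain ⟨hfin, hQ, hirr, hp, hkt⟩ := h
    have hlist : kept ++ [A] ++ todo = kept ++ A :: todo := by simp
    push Not at hA
    refine ⟨by rwa [hlist], by rwa [hlist], by rwa [hlist], ?_, fun B hB C hC => ?_⟩
    · refine List.pairwise_append.2 ⟨hp, List.pairwise_singleton _ _, fun B hB C hC => ?_⟩
      obtain rfl := List.mem_singleton.1 hC
      exact ⟨hkt B hB C (by simp), hA B (by simp [hB])⟩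
    · simp only [List.mem_append, List.mem_singleton] at hB
      rcases hB with hB | rfl
      · exact hkt B hB C (by simp [hC])
      · exact hA C (by simp [hC])

/-! ### Termination of `MinGenSet` -/

theorem MGInv.progress {Q : Set (Alg L)} {c : MGConfig L} (h : MGInv Q c) :
    (∃ R, MGReturns c R) ∨ ∃ c', MGStep c c' := by
  classical
  cases c with
  | scan done todo =>
    cases todo with
    | nil => exact Or.inr ⟨_, .scanned done⟩
    | cons A todo =>
      refine Or.inr ?_
      by_cases hm : meet (S₁ A ∪ S₂ A (done ++ todo)) = ⊥
      · have : Finite A := h.1 A (by simp)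
        have hf : (S₁ A \ S₂ A (done ++ todo)).Finite := Set.toFinite _
        exact ⟨_, .split done todo A hf.toFinset.toList hm (Finset.nodup_toList _) (by simp)⟩
      · exact ⟨_, .next done todo A hm⟩
  | prune kept todo =>
    cases todo with
    | nil => exact Or.inl ⟨kept.toFinset, kept, rfl, fun A => List.mem_toFinset⟩
    | cons A todo =>
      refine Or.inr ?_
      by_cases hA : ∃ B ∈ kept ++ todo, Embeds A B
      · exact ⟨_, .drop kept todo A hA⟩
      · exact ⟨_, .keep kept todo A hA⟩

theorem acc_prune (kept todo : List (Alg L)) :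
    Acc (fun c' c => MGStep c c') (MGConfig.prune kept todo) := by
  induction todo generalizing kept with
  | nil => exact ⟨_, fun c' hs => by cases hs⟩
  | cons A todo ih =>
    refine ⟨_, fun c' hs => ?_⟩
    cases hs with
    | drop => exact ih _
    | keep => exact ih _

/-- In the scanning phase a step removes the current algebra from the algebras still to be treated
and adds finitely many smaller ones, so that the multiset of their sizes decreases. -/
theorem MGInv.acc {Q : Set (Alg L)} {c : MGConfig L} (h : MGInv Q c) :
    Acc (fun c' c => MGStep c c') c := by
  cases c with
  | prune kept todo => exact acc_prune kept todo
  | scan done todo =>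
    have hwf := WellFounded.cutExpand (r := fun a b : ℕ => a < b) wellFounded_lt
    generalize hm : ((todo.map fun A : Alg L => Nat.card A : List ℕ) : Multiset ℕ) = m
    induction m using hwf.induction generalizing done todo with
    | _ m ih =>
      refine ⟨_, fun c' hs => ?_⟩
      have h' := h.step hs
      cases hs with
      | scanned => exact acc_prune _ _
      | next _ todo A _ =>
        refine ih _ ?_ _ _ h' rfl
        refine ⟨0, Nat.card A, by simp, ?_⟩
        rw [← hm, add_zero, List.map_cons, ← Multiset.cons_coe, add_comm, Multiset.singleton_add]
      | split _ todo A ts _ _ hts =>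
        refine ih _ ?_ _ _ h' rfl
        have : Finite A := h.1 A (by simp)
        refine ⟨((ts.map (quot A)).map fun A : Alg L => Nat.card A : List ℕ), Nat.card A, ?_, ?_⟩
        · intro n hn
          simp only [List.map_map, Multiset.mem_coe, List.mem_map] at hn
          obtain ⟨θ, hθ, rfl⟩ := hn
          exact card_quot_lt ((hts θ).1 hθ).1.1
        · rw [← hm, List.map_cons, ← Multiset.cons_coe, List.map_append, ← Multiset.coe_add,
            ← Multiset.singleton_add]
          abel

/-! ### Correctness of `AdmAlgs` -/

/-- The invariant of the main loop: `D` generates `Q(K)`, the algebras collected so far are finite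
members of `Q(F_K(ω))`, and every member of `D` is a homomorphic image of one of them or has still
to be treated. -/
structure LoopInv (K : Set (Alg L)) (D : Finset (Alg L)) (todo : List (Alg L))
    (𝒜 : Finset (Alg L)) : Prop where
  finAlgs : FinAlgs D
  quasivariety_eq : quasivariety (D : Set (Alg L)) = quasivariety K
  todo_subset : ∀ A ∈ todo, A ∈ D
  collected_finAlgs : FinAlgs 𝒜
  collected_mem : ∀ B ∈ 𝒜, B ∈ quasivariety {freeOmega K}
  cover : ∀ A ∈ D, A ∈ todo ∨ ∃ B ∈ 𝒜, IsHomImage A B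

/-- The invariant of `AdmAlgs`. -/
def Inv (K : Set (Alg L)) : Config L → Prop
  | .first c => MGInv (quasivariety K) c
  | .loop D todo 𝒜 => LoopInv K D todo 𝒜
  | .free D todo 𝒜 A m => LoopInv K D (A :: todo) 𝒜 ∧ ∀ k < m,
      ¬ ∃ _ : Nonempty (L.Term (Fin k)), IsHomImage A (freeAlg (D : Set (Alg L)) (Fin k))
  | .shrink D todo 𝒜 A B => LoopInv K D (A :: todo) 𝒜 ∧ Finite B ∧
      B ∈ quasivariety {freeOmega K} ∧ IsHomImage A B
  | .last c => MGInv (quasivariety {freeOmega K}) c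
  | .done R => IsReducedGenSet (quasivariety {freeOmega K}) R

theorem LoopInv.insert [DecidableEq (Alg L)] {K : Set (Alg L)} {D : Finset (Alg L)}
    {todo : List (Alg L)} {𝒜 : Finset (Alg L)} {A B : Alg L} (h : LoopInv K D (A :: todo) 𝒜)
    (hfin : Finite B) (hB : B ∈ quasivariety {freeOmega K}) (hAB : IsHomImage A B) :
    LoopInv K D todo (insert B 𝒜) where
  finAlgs := h.finAlgs
  quasivariety_eq := h.quasivariety_eq
  todo_subset C hC := h.todo_subset C (List.mem_cons_of_mem _ hC)
  collected_finAlgs C hC := by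
    rcases Finset.mem_insert.1 hC with rfl | hC
    · exact hfin
    · exact h.collected_finAlgs C hC
  collected_mem C hC := by
    rcases Finset.mem_insert.1 hC with rfl | hC
    · exact hB
    · exact h.collected_mem C hC
  cover C hC := by
    rcases h.cover C hC with hC | ⟨E, hE, hCE⟩
    · rcases List.mem_cons.1 hC with rfl | hC
      · exact Or.inr ⟨B, Finset.mem_insert_self _ _, hAB⟩
      · exact Or.inl hC
    · exact Or.inr ⟨E, Finset.mem_insert_of_mem hE, hCE⟩

theorem Inv.step {K : Set (Alg L)} {c c' : Config L} (h : Inv K c) (hs : Step c c') :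
    Inv K c' := by
  cases hs with
  | first c c' hc => exact MGInv.step h hc
  | enter c D l hD hl =>
    have hr := MGInv.isReducedGenSet h hD
    exact ⟨hr.finAlgs, hr.quasivariety_eq, fun A => (hl.2 A).1, by simp [FinAlgs], by simp,
      fun A hA => Or.inl ((hl.2 A).2 hA)⟩
  | pick D todo 𝒜 A => exact ⟨h, by simp⟩
  | found D todo 𝒜 A m hm hA =>
    obtain ⟨h, -⟩ := h
    refine ⟨h, finite_freeAlg h.finAlgs, ?_, hA⟩
    have hemb := freeAlg_fin_embeds_freeOmega (D : Set (Alg L)) m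
    rw [freeOmega_congr h.quasivariety_eq] at hemb
    exact hemb.mem_quasivariety (subset_quasivariety _ rfl)
  | more D todo 𝒜 A m hA =>
    refine ⟨h.1, fun k hk => ?_⟩
    rcases Nat.lt_succ_iff_lt_or_eq.1 hk with hk | rfl
    · exact h.2 k hk
    · exact hA
  | smaller D todo 𝒜 A B C hC _ hA =>
    obtain ⟨h, hfin, hB, -⟩ := h
    exact ⟨h, (embeds_sub B C hC).finite, (embeds_sub B C hC).mem_quasivariety hB, hA⟩
  | add D todo 𝒜 A B _ =>
    obtain ⟨h, hfin, hB, hA⟩ := h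
    classical exact h.insert hfin hB hA
  | leave D 𝒜 l hl =>
    have h : LoopInv K D [] 𝒜 := h
    have hQ : quasivariety (𝒜 : Set (Alg L)) = quasivariety {freeOmega K} := by
      rw [← freeOmega_congr h.quasivariety_eq]
      refine quasivariety_eq_freeOmega (fun B hB => ?_) fun A hA => ?_
      · rw [freeOmega_congr h.quasivariety_eq]
        exact h.collected_mem B hB
      · exact (h.cover A hA).resolve_left List.not_mem_nil
    have := mgInv_start h.collected_finAlgs hl
    rwa [hQ] at this
  | last c c' hc => exact MGInv.step h hc
  | finish c R hR => exact MGInv.isReducedGenSet h hR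

theorem Inv.progress {K : Set (Alg L)} {c : Config L} (h : Inv K c) :
    (∃ R, c = .done R) ∨ ∃ c', Step c c' := by
  classical
  cases c with
  | first c =>
    refine Or.inr ?_
    rcases MGInv.progress h with ⟨D, hD⟩ | ⟨c', hc⟩
    · exact ⟨_, .enter c D D.toList hD ⟨D.nodup_toList, fun _ => Finset.mem_toList⟩⟩
    · exact ⟨_, .first c c' hc⟩
  | loop D todo 𝒜 =>
    refine Or.inr ?_
    cases todo with
    | nil => exact ⟨_, .leave D 𝒜 𝒜.toList ⟨𝒜.nodup_toList, fun _ => Finset.mem_toList⟩⟩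
    | cons A todo => exact ⟨_, .pick D todo 𝒜 A⟩
  | free D todo 𝒜 A m =>
    refine Or.inr ?_
    by_cases hm : ∃ _ : Nonempty (L.Term (Fin m)),
        IsHomImage A (freeAlg (D : Set (Alg L)) (Fin m))
    · obtain ⟨hm, hA⟩ := hm
      exact ⟨_, .found D todo 𝒜 A m hm hA⟩
    · exact ⟨_, .more D todo 𝒜 A m hm⟩
  | shrink D todo 𝒜 A B =>
    refine Or.inr ?_
    by_cases hB : ∃ (C : L.Substructure B) (hC : (C : Set B).Nonempty),
        C ≠ ⊤ ∧ IsHomImage A (sub B C hC)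
    · obtain ⟨C, hC, hne, hA⟩ := hB
      exact ⟨_, .smaller D todo 𝒜 A B C hC hne hA⟩
    · exact ⟨_, .add D todo 𝒜 A B hB⟩
  | last c =>
    refine Or.inr ?_
    rcases MGInv.progress h with ⟨R, hR⟩ | ⟨c', hc⟩
    · exact ⟨_, .finish c R hR⟩
    · exact ⟨_, .last c c' hc⟩
  | done R => exact Or.inl ⟨R, rfl⟩

/-! ### Termination of `AdmAlgs` -/

theorem acc_last {K : Set (Alg L)} {c : MGConfig L} (h : Inv K (.last c)) :
    Acc (fun c' c => Step c c') (Config.last c) := by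
  have hacc := MGInv.acc (c := c) h
  induction hacc with
  | intro c _ ih =>
    refine ⟨_, fun d hd => ?_⟩
    have hinv := h.step hd
    cases hd with
    | last _ c' hc => exact ih c' hc hinv
    | finish _ R _ => exact ⟨_, fun d hd => by cases hd⟩

theorem acc_shrink {K : Set (Alg L)} {D : Finset (Alg L)} {todo : List (Alg L)}
    {𝒜 : Finset (Alg L)} {A B : Alg L} (h : Inv K (.shrink D todo 𝒜 A B))
    (hloop : ∀ ℬ, Inv K (.loop D todo ℬ) → Acc (fun c' c => Step c c') (Config.loop D todo ℬ)) :
    Acc (fun c' c => Step c c') (Config.shrink D todo 𝒜 A B) := by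
  generalize hn : Nat.card B = n
  induction n using Nat.strong_induction_on generalizing B with
  | _ n ih =>
    refine ⟨_, fun d hd => ?_⟩
    have hinv := h.step hd
    cases hd with
    | smaller _ _ _ _ _ C hC hne _ =>
      have : Finite B := h.2.1
      exact ih _ (hn ▸ card_sub_lt hC hne) hinv rfl
    | add => exact hloop _ hinv

theorem acc_free {K : Set (Alg L)} {D : Finset (Alg L)} {todo : List (Alg L)}
    {𝒜 : Finset (Alg L)} {A : Alg L} {m : ℕ} (h : Inv K (.free D todo 𝒜 A m))
    (hloop : ∀ ℬ, Inv K (.loop D todo ℬ) → Acc (fun c' c => Step c c') (Config.loop D todo ℬ)) :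
    Acc (fun c' c => Step c c') (Config.free D todo 𝒜 A m) := by
  have hA : A ∈ D := h.1.todo_subset A List.mem_cons_self
  have : Finite A := h.1.finAlgs A hA
  obtain ⟨N, hN⟩ := exists_isHomImage_freeAlg (K := (D : Set (Alg L))) hA
  generalize hn : N + 1 - m = n
  induction n using Nat.strong_induction_on generalizing m with
  | _ n ih =>
    have hm : m ≤ N := not_lt.1 fun hlt => h.2 N hlt hN
    refine ⟨_, fun d hd => ?_⟩
    have hinv := h.step hd
    cases hd with
    | found => exact acc_shrink hinv hloop
    | more => exact ih (N + 1 - (m + 1)) (by omega) hinv rfl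

theorem acc_loop {K : Set (Alg L)} {D : Finset (Alg L)} {todo : List (Alg L)}
    {𝒜 : Finset (Alg L)} (h : Inv K (.loop D todo 𝒜)) :
    Acc (fun c' c => Step c c') (Config.loop D todo 𝒜) := by
  induction todo generalizing 𝒜 with
  | nil =>
    refine ⟨_, fun d hd => ?_⟩
    have hinv := h.step hd
    cases hd with
    | leave => exact acc_last hinv
  | cons A todo ih =>
    refine ⟨_, fun d hd => ?_⟩
    have hinv := h.step hd
    cases hd with
    | pick => exact acc_free hinv fun ℬ hℬ => ih hℬ

theorem acc_first {K : Set (Alg L)} {c : MGConfig L} (h : Inv K (.first c)) :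
    Acc (fun c' c => Step c c') (Config.first c) := by
  have hacc := MGInv.acc (c := c) h
  induction hacc with
  | intro c _ ih =>
    refine ⟨_, fun d hd => ?_⟩
    have hinv := h.step hd
    cases hd with
    | first _ c' hc => exact ih c' hc hinv
    | enter => exact acc_loop hinv

theorem Inv.of_reachable {K : Finset (Alg L)} (hK : FinAlgs K) {c : Config L}
    (hc : Reachable K c) : Inv (K : Set (Alg L)) c := by
  obtain ⟨_, ⟨l, hl, rfl⟩, hr⟩ := hc
  induction hr with
  | refl => exact mgInv_start hK hl
  | tail _ hs ih => exact ih.step hs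

theorem admAlgsTerminates {K : Finset (Alg L)} (hK : FinAlgs K) : AdmAlgsTerminates K := by
  refine ⟨⟨_, K.toList, ⟨K.nodup_toList, fun _ => Finset.mem_toList⟩, rfl⟩, ?_,
    fun c hc => (Inv.of_reachable hK hc).progress⟩
  rintro ⟨r, ⟨l, hl, hr0⟩, hr⟩
  have hacc : Acc (fun c' c => Step c c') (r 0) := by
    rw [hr0]
    exact acc_first (K := (K : Set (Alg L))) (mgInv_start hK hl)
  exact not_acc_iff_exists_descending_chain.2 ⟨r, rfl, hr⟩ hacc

end Algebraic

end UAlg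

theorem mainTheorem8 (L : FirstOrder.Language.{u, v}) [L.IsAlgebraic]
    (K : Finset (UAlg.Alg L)) (hK : UAlg.FinAlgs K) :
    -- every run of the algorithm on `K` terminates and returns a set
    UAlg.AdmAlgsTerminates K ∧
    ∀ R : Finset (UAlg.Alg L), UAlg.AdmAlgsReturns K R →
      -- the returned set is the minimal generating set of `Q(F_K(ω))`, unique up to isomorphism
      UAlg.IsMinGenSet (UAlg.quasivariety {UAlg.freeOmega (K : Set (UAlg.Alg L))}) R ∧
      (∀ S : Finset (UAlg.Alg L),
        UAlg.IsMinGenSet (UAlg.quasivariety {UAlg.freeOmega (K : Set (UAlg.Alg L))}) S →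
          UAlg.SameUpToIso R S) ∧
      -- it is the optimal finite set of finite algebras capturing `K`-admissibility
      UAlg.IsOptimalForAdmissibility (K : Set (UAlg.Alg L)) R ∧
      (∀ S : Finset (UAlg.Alg L),
        UAlg.IsOptimalForAdmissibility (K : Set (UAlg.Alg L)) S → UAlg.SameUpToIso R S) := by
  refine ⟨UAlg.admAlgsTerminates hK, fun R hR => ?_⟩
  have h : UAlg.IsReducedGenSet _ R := UAlg.Inv.of_reachable hK hR
  simp only [UAlg.isOptimalForAdmissibility_iff]
  exact ⟨h.isMinGenSet, fun S => h.sameUpToIso, h.isMinGenSet, fun S => h.sameUpToIso⟩
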